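/- Let $P$ be a convex polygon in the plane (including its interior), with $n\ge 3$ vertices listed counterclockwise. An actuator at a point $w\in P$, when activated, moves every particle so as to locally increase its distance from $w$: a particle in the interior of $P$ moves in a straight line away from $w$ until it hits the boundary; a particle on an edge moves along that edge in the direction in which its distance from $w$ increases (counterclockwise if both directions increase it); a particle stops at a vertex at which neither of the two incident edges allows a movement away from $w$. Initially there is a particle on every point of $P$. The first actuator is placed at any point of $P$, and the particle at that point is removed; every later actuator is placed at a point of $P$ that carries no particle at that time. Particles that meet are identified. $P$ is called $k$-gatherable if there is a sequence of $k$ such successive activations after which all the particles are at one single point. Theorem. Every convex polygon with at most two acute vertices (vertices at which the interior angle is less than $\pi/2$) is $2$-gatherable. -/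

import Mathlib

/-- Twice the signed area of the triangle `a b c`; it is positive iff `c` lies strictly to the left
of the directed line from `a` to `b`. -/
def signedArea (a b c : EuclideanSpace ℝ (Fin 2)) : ℝ :=
  (b 0 - a 0) * (c 1 - a 1) - (b 1 - a 1) * (c 0 - a 0)

namespace Polygon

/-- A (nondegenerate) convex polygon whose vertices are listed counterclockwise: there are at least
three vertices, and every vertex that is not an endpoint of a given edge lies strictly to the left
of the directed line through this edge. -/
structure IsConvexCCW {n : ℕ} (P : Polygon (EuclideanSpace ℝ (Fin 2)) n) : Prop where
  three_le : 3 ≤ n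
  left_of_edge : ∀ i j : Fin n, j ≠ i → j ≠ finRotate n i →
    0 < signedArea (P i) (P (finRotate n i)) (P j)

/-- The closed region bounded by a convex polygon. -/
def region {n : ℕ} (P : Polygon (EuclideanSpace ℝ (Fin 2)) n) :
    Set (EuclideanSpace ℝ (Fin 2)) :=
  convexHull ℝ (Set.range P.vertices)

/-- The vertex `P i` is acute: the angle of the polygon there is less than a right angle. -/
def IsAcuteVertex {n : ℕ} (P : Polygon (EuclideanSpace ℝ (Fin 2)) n) (i : Fin n) : Prop :=
  EuclideanGeometry.angle (P ((finRotate n).symm i)) (P i) (P (finRotate n i)) < Real.pi / 2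

/-- Along the straight path from `x` to `y` the distance from `w` strictly increases. -/
def MovesAway (w x y : EuclideanSpace ℝ (Fin 2)) : Prop :=
  StrictMonoOn (fun t : ℝ => dist w (AffineMap.lineMap x y t)) (Set.Icc 0 1)

/-- With an active actuator at `w`, a particle at `x` on the boundary moves counterclockwise along
its edge up to the endpoint `y` of this edge. A particle at a vertex counts as being at the start
of the edge that follows it counterclockwise. -/
def StepCCW {n : ℕ} (P : Polygon (EuclideanSpace ℝ (Fin 2)) n)
    (w x y : EuclideanSpace ℝ (Fin 2)) : Prop :=
  ∃ i : Fin n, x ∈ P.edgeSet ℝ i ∧ y = P (finRotate n i) ∧ x ≠ y ∧ MovesAway w x y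

/-- Along its edge a particle at `x` can move away from `w` in clockwise direction, up to the
endpoint `y` of this edge. -/
def CanMoveCW {n : ℕ} (P : Polygon (EuclideanSpace ℝ (Fin 2)) n)
    (w x y : EuclideanSpace ℝ (Fin 2)) : Prop :=
  ∃ i : Fin n, x ∈ P.edgeSet ℝ i ∧ y = P i ∧ x ≠ y ∧ MovesAway w x y

/-- The straight pieces of the movement of a particle while an actuator is active at `w`. -/
inductive Step {n : ℕ} (P : Polygon (EuclideanSpace ℝ (Fin 2)) n)
    (w : EuclideanSpace ℝ (Fin 2)) :
    EuclideanSpace ℝ (Fin 2) → EuclideanSpace ℝ (Fin 2) → Prop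
  /-- A particle inside the polygon moves straight away from `w` until it hits the boundary. -/
  | inside (x y : EuclideanSpace ℝ (Fin 2)) (t : ℝ) (hx : x ∈ P.region)
      (hx' : x ∉ P.boundary ℝ) (hy : y ∈ P.boundary ℝ) (ht : 0 < t)
      (hxy : y = x + t • (x - w)) : Step P w x y
  /-- A particle on the boundary moves counterclockwise if this takes it away from `w`. -/
  | ccw (x y : EuclideanSpace ℝ (Fin 2)) (h : P.StepCCW w x y) : Step P w x y
  /-- A particle on the boundary moves clockwise if this takes it away from `w`, and moving
  counterclockwise does not (at an unstable maximum the particle moves counterclockwise if it has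
  the choice). -/
  | cw (x y : EuclideanSpace ℝ (Fin 2)) (h : P.CanMoveCW w x y)
      (h' : ∀ z, ¬ P.StepCCW w x z) : Step P w x y

/-- When an actuator at `w` is activated, a particle that is at `x` moves until it is stable, and
its final position is `a`. -/
def ComesToRest {n : ℕ} (P : Polygon (EuclideanSpace ℝ (Fin 2)) n)
    (w x a : EuclideanSpace ℝ (Fin 2)) : Prop :=
  Relation.ReflTransGen (P.Step w) x a ∧ ∀ y, ¬ P.Step w a y

/-- The activation of an actuator at `w`, with particles exactly on the points of `S`, brings every
particle to rest, and `T` is the set of the final positions. -/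
def Activation {n : ℕ} (P : Polygon (EuclideanSpace ℝ (Fin 2)) n)
    (w : EuclideanSpace ℝ (Fin 2)) (S T : Set (EuclideanSpace ℝ (Fin 2))) : Prop :=
  (∀ x ∈ S, ∃ a ∈ T, P.ComesToRest w x a) ∧ (∀ a ∈ T, ∃ x ∈ S, P.ComesToRest w x a)

/-- `P.Reachable k S`: some sequence of `k ≥ 1` successive activations from points of the polygon
leaves particles exactly on the points of `S`. -/
inductive Reachable {n : ℕ} (P : Polygon (EuclideanSpace ℝ (Fin 2)) n) :
    ℕ → Set (EuclideanSpace ℝ (Fin 2)) → Prop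
  /-- At the beginning there is a particle on every point of the polygon; the particle at the
  location of the first actuator is removed. -/
  | first (w : EuclideanSpace ℝ (Fin 2)) (T : Set (EuclideanSpace ℝ (Fin 2)))
      (hw : w ∈ P.region) (hT : P.Activation w (P.region \ {w}) T) : Reachable P 1 T
  /-- Every later actuator is at a point of the polygon that is free of particles. -/
  | next (k : ℕ) (w : EuclideanSpace ℝ (Fin 2)) (S T : Set (EuclideanSpace ℝ (Fin 2)))
      (hS : Reachable P k S) (hw : w ∈ P.region) (hwS : w ∉ S) (hT : P.Activation w S T) :
      Reachable P (k + 1) T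

/-- `k` successive activations can gather all the particles to one point. -/
def IsGatherable {n : ℕ} (P : Polygon (EuclideanSpace ℝ (Fin 2)) n) (k : ℕ) : Prop :=
  ∃ a : EuclideanSpace ℝ (Fin 2), P.Reachable k {a}

end Polygon

/-!
The whole proof compares directions from vertices of the polygon. A particle at rest, away from the
actuator `u`, sits at a *stable* vertex: one that makes acute angles with `u` and each of its two
neighbours. Successive positions of a particle move away from `u`, and on the boundary they are
vertices, so every particle comes to rest (`exists_comesToRest`).

The first actuator is at a vertex `a` that sees the vertices stable with respect to it within a
right angle. An acute vertex has this property. If there is none, such an `a` is found by descent: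
suppose that every vertex `a` sees some two stable vertices at an obtuse angle, and that one of
`x`, `y` is stable with respect to the other, say `y` with respect to `x`. Then `y` sees `x` at an
acute angle with every vertex, so the obtuse pair seen from `y` has `x` strictly between its two
members. So the chain between `x` and `y`, on either side, contains a member of the pair in its
interior. This member is stable with respect to `y` and bounds together with `y` a shorter chain
(`not_isStable_of_forall_obtuse`).

Let `v` and `w` be the first and the last vertex that carry a particle after the first activation,
and let `i` lie strictly between them. In the quadrilateral `a v i w` the angles at `v` and `w` are
acute and the angle at `a` is not obtuse, so the angle at `i` is obtuse
(`dotAt_neg_of_quadrilateral`). So an actuator close to `v` drives every particle along the chain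
towards `w`, and one close to `w` drives it towards `v`. The actuator can be put on the edge before
`v` if `v` is not acute (`exists_actuator_ccw`), and on the edge after `w` if `w` is not acute
(`exists_actuator_cw`); one of these holds, because `a` is acute if any vertex is, and there are at
most two acute vertices.
-/

/-! ### Angles and orientation in coordinates -/

/-- The Euclidean plane. -/
abbrev Plane : Type := EuclideanSpace ℝ (Fin 2)

/-- The inner product of `a - o` and `b - o`, in coordinates. For `a, b ≠ o` it is positive iff the
angle at `o` between `a` and `b` is acute. -/
def dotAt (o a b : Plane) : ℝ :=
  (a 0 - o 0) * (b 0 - o 0) + (a 1 - o 1) * (b 1 - o 1)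

theorem Plane.ext {a b : Plane} (h0 : a 0 = b 0) (h1 : a 1 = b 1) : a = b := by
  ext i; fin_cases i <;> assumption

theorem dotAt_comm (o a b : Plane) : dotAt o a b = dotAt o b a := by
  unfold dotAt; ring

theorem dotAt_self_nonneg (o a : Plane) : 0 ≤ dotAt o a a := by
  unfold dotAt; exact add_nonneg (mul_self_nonneg _) (mul_self_nonneg _)

theorem dotAt_self_pos {o a : Plane} (h : o ≠ a) : 0 < dotAt o a a := by
  refine lt_of_le_of_ne (dotAt_self_nonneg o a) fun h0 => h ?_
  unfold dotAt at h0
  apply Plane.ext <;> nlinarith [sq_nonneg (a 0 - o 0), sq_nonneg (a 1 - o 1)]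

theorem ne_of_signedArea_ne_zero_right {o a c : Plane} (h : signedArea o a c ≠ 0) : o ≠ c := by
  rintro rfl; apply h; unfold signedArea; ring

theorem ne_of_signedArea_ne_zero_left {o a c : Plane} (h : signedArea o a c ≠ 0) : o ≠ a := by
  rintro rfl; apply h; unfold signedArea; ring

theorem signedArea_rotate (a b c : Plane) : signedArea a b c = signedArea b c a := by
  unfold signedArea; ring

/-- If `b` lies in the cone at `o` spanned by `a` and `c` and this cone is not obtuse, then the part
of the cone between `b` and `c` is acute. -/
theorem dotAt_pos_of_cone_right {o a b c : Plane} (hac : 0 < signedArea o a c)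
    (hab : 0 < signedArea o a b) (hbc : 0 ≤ signedArea o b c) (h : 0 ≤ dotAt o a c) :
    0 < dotAt o b c := by
  have key : signedArea o a c * dotAt o b c
      = signedArea o b c * dotAt o a c + signedArea o a b * dotAt o c c := by
    unfold signedArea dotAt; ring
  have hc := dotAt_self_pos (ne_of_signedArea_ne_zero_right hac.ne')
  have : 0 < signedArea o a c * dotAt o b c := by rw [key]; positivity
  exact pos_of_mul_pos_right this hac.le

/-- If `b` lies in the cone at `o` spanned by `a` and `c` and this cone is not obtuse, then the part
of the cone between `a` and `b` is acute. -/
theorem dotAt_pos_of_cone_left {o a b c : Plane} (hac : 0 < signedArea o a c)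
    (hab : 0 ≤ signedArea o a b) (hbc : 0 < signedArea o b c) (h : 0 ≤ dotAt o a c) :
    0 < dotAt o a b := by
  have key : signedArea o a c * dotAt o a b
      = signedArea o a b * dotAt o a c + signedArea o b c * dotAt o a a := by
    unfold signedArea dotAt; ring
  have ha := dotAt_self_pos (ne_of_signedArea_ne_zero_left hac.ne')
  have : 0 < signedArea o a c * dotAt o a b := by rw [key]; positivity
  exact pos_of_mul_pos_right this hac.le

/-- In a convex quadrilateral `o v x w` whose angle at `o` is not obtuse and whose angles at `v` and
`w` are acute, the angle at `x` is obtuse. -/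
theorem dotAt_neg_of_quadrilateral {o v x w : Plane} (hvw : 0 < signedArea o v w)
    (hvx : 0 < signedArea o v x) (hxw : 0 < signedArea o x w) (hvxw : 0 < signedArea v x w)
    (ho : 0 ≤ dotAt o v w) (hv : 0 < dotAt v o x) (hw : 0 < dotAt w o x) :
    dotAt x v w < 0 := by
  -- `x - o = (α • (v - o) + β • (w - o)) / D`
  obtain ⟨D, hD⟩ : ∃ D, D = signedArea o v w := ⟨_, rfl⟩
  obtain ⟨α, hα⟩ : ∃ α, α = signedArea o x w := ⟨_, rfl⟩
  obtain ⟨β, hβ⟩ : ∃ β, β = signedArea o v x := ⟨_, rfl⟩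
  have hsum : signedArea v x w = α + β - D := by
    rw [hα, hβ, hD]; unfold signedArea; ring
  have h1 : D * dotAt v o x = (D - α) * dotAt o v v - β * dotAt o v w := by
    rw [hα, hβ, hD]; unfold signedArea dotAt; ring
  have h2 : D * dotAt w o x = (D - β) * dotAt o w w - α * dotAt o v w := by
    rw [hα, hβ, hD]; unfold signedArea dotAt; ring
  have h3 : D * D * dotAt x v w = -(α * (D * dotAt v o x)) - β * (D * dotAt w o x)
      + D * (D - α - β) * dotAt o v w := by
    rw [h1, h2, hα, hβ, hD]; unfold signedArea dotAt; ring
  rw [← hD] at hvw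
  rw [← hα] at hxw
  rw [← hβ] at hvx
  rw [hsum] at hvxw
  have : D * D * dotAt x v w < 0 := by
    rw [h3]
    have e1 : 0 < α * (D * dotAt v o x) := by positivity
    have e2 : 0 < β * (D * dotAt w o x) := by positivity
    have e3 : 0 ≤ D * (α + β - D) * dotAt o v w := by positivity
    nlinarith
  exact neg_of_mul_neg_right this (by positivity)

theorem dist_sq_eq_dotAt (w x : Plane) : dist w x ^ 2 = dotAt w x x := by
  rw [EuclideanSpace.dist_eq, Real.sq_sqrt (by positivity)]
  simp only [Fin.sum_univ_two, Real.dist_eq, sq_abs]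
  unfold dotAt; ring

theorem dist_lt_dist_iff_dotAt (w x y : Plane) :
    dist w x < dist w y ↔ dotAt w x x < dotAt w y y := by
  rw [← dist_sq_eq_dotAt, ← dist_sq_eq_dotAt, sq_lt_sq₀ dist_nonneg dist_nonneg]

theorem lineMap_coord (x y : Plane) (t : ℝ) (i : Fin 2) :
    (AffineMap.lineMap x y t : Plane) i = x i + t * (y i - x i) := by
  simp [AffineMap.lineMap_apply]; ring

theorem dotAt_lineMap (w x y : Plane) (t : ℝ) :
    dotAt w (AffineMap.lineMap x y t) (AffineMap.lineMap x y t)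
      = dotAt w x x - 2 * t * dotAt x w y + t ^ 2 * dotAt x y y := by
  unfold dotAt; simp only [lineMap_coord]; ring

namespace Polygon

/-- The distance from `w` increases along the whole segment as soon as it does not decrease at
its start. -/
theorem movesAway_of_dotAt_nonpos {w x y : Plane} (hxy : x ≠ y) (h : dotAt x w y ≤ 0) :
    MovesAway w x y := by
  intro s hs t ht hst
  simp only [Set.mem_Icc] at hs ht
  change dist _ _ < dist _ _
  rw [dist_lt_dist_iff_dotAt, dotAt_lineMap, dotAt_lineMap]
  have h1 := dotAt_self_pos hxy
  have h2 : 0 < (t ^ 2 - s ^ 2) * dotAt x y y := by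
    apply mul_pos _ h1; nlinarith
  nlinarith

theorem MovesAway.dotAt_nonpos {w x y : Plane} (h : MovesAway w x y) : dotAt x w y ≤ 0 := by
  by_contra! hpos
  have hlt : ∀ t : ℝ, 0 < t → t ≤ 1 → 2 * dotAt x w y < t * dotAt x y y := by
    intro t h0 h1
    have := h (Set.left_mem_Icc.2 zero_le_one) (Set.mem_Icc.2 ⟨h0.le, h1⟩) h0
    change dist _ _ < dist _ _ at this
    rw [dist_lt_dist_iff_dotAt, dotAt_lineMap, dotAt_lineMap] at this
    nlinarith
  have hy : 0 < dotAt x y y := by have := hlt 1 one_pos le_rfl; linarith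
  have := hlt (min 1 (dotAt x w y / dotAt x y y)) (by positivity) (min_le_left _ _)
  have h2 : min 1 (dotAt x w y / dotAt x y y) * dotAt x y y
      ≤ dotAt x w y / dotAt x y y * dotAt x y y :=
    mul_le_mul_of_nonneg_right (min_le_right _ _) hy.le
  rw [div_mul_cancel₀ _ hy.ne'] at h2
  linarith

theorem MovesAway.dist_lt {w x y : Plane} (h : MovesAway w x y) : dist w x < dist w y := by
  have := h (Set.left_mem_Icc.2 zero_le_one) (Set.right_mem_Icc.2 zero_le_one) one_pos
  simpa using this

end Polygon

theorem angle_lt_pi_div_two_iff_dotAt (a o b : Plane) :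
    EuclideanGeometry.angle a o b < Real.pi / 2 ↔ 0 < dotAt o a b := by
  have hin : inner ℝ (a -ᵥ o) (b -ᵥ o) = dotAt o a b := by
    simp [PiLp.inner_apply, Fin.sum_univ_two, dotAt]; ring
  unfold EuclideanGeometry.angle InnerProductGeometry.angle
  rw [Real.arccos_lt_pi_div_two, hin]
  constructor
  · intro h
    by_contra! h'
    exact absurd h (not_lt.2 (div_nonpos_of_nonpos_of_nonneg h' (by positivity)))
  · intro h
    have ha : a -ᵥ o ≠ 0 := by
      intro h0; rw [h0, inner_zero_left] at hin; linarith
    have hb : b -ᵥ o ≠ 0 := by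
      intro h0; rw [h0, inner_zero_right] at hin; linarith
    have := norm_pos_iff.2 ha
    have := norm_pos_iff.2 hb
    positivity

namespace Polygon

theorem IsConvexCCW.three_le_cast {n : ℕ} {P : Polygon Plane n} (hP : P.IsConvexCCW) :
    (3 : ℤ) ≤ n := by
  exact_mod_cast hP.three_le

variable {n : ℕ} [NeZero n] {P : Polygon Plane n}

/-! ### Vertices with integer indices -/

open Fin.CommRing in
/-- The vertices of a polygon as a sequence indexed by the integers, of period `n`, so that indices
can be compared along a chain that passes the last vertex. -/
def vtx (P : Polygon Plane n) (m : ℤ) : Plane := P (m : Fin n)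

open Fin.CommRing in
theorem vtx_add_period (P : Polygon Plane n) (m : ℤ) : P.vtx (m + n) = P.vtx m := by
  unfold vtx
  congr 1
  exact (CharP.intCast_eq_intCast (Fin n) n).2 (by simp)

open Fin.CommRing in
theorem exists_intCast_fin (i : Fin n) (a : ℤ) :
    ∃ m : ℤ, a ≤ m ∧ m < a + n ∧ (m : Fin n) = i := by
  have hn : (0 : ℤ) < n := by exact_mod_cast Nat.pos_of_ne_zero (NeZero.ne n)
  refine ⟨a + ((i.val : ℤ) - a) % n, ?_, ?_, ?_⟩
  · linarith [Int.emod_nonneg ((i.val : ℤ) - a) hn.ne']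
  · linarith [Int.emod_lt_of_pos ((i.val : ℤ) - a) hn]
  · have : ((i.val : ℤ) : Fin n) = i := by simp
    conv_rhs => rw [← this]
    rw [CharP.intCast_eq_intCast (Fin n) n]
    calc a + ((i.val : ℤ) - a) % n ≡ a + ((i.val : ℤ) - a) [ZMOD n] :=
          Int.ModEq.add_left a (Int.mod_modEq _ _)
      _ = i.val := by ring

theorem exists_vtx_eq (P : Polygon Plane n) (i : Fin n) (a : ℤ) :
    ∃ m : ℤ, a ≤ m ∧ m < a + n ∧ P.vtx m = P i := by
  obtain ⟨m, h1, h2, h3⟩ := exists_intCast_fin i a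
  exact ⟨m, h1, h2, by rw [vtx, h3]⟩

/-- Every index is congruent to one in a given period. -/
theorem exists_add_mul_period (n : ℕ) [NeZero n] (m a : ℤ) :
    ∃ m' c : ℤ, m' = m + c * n ∧ a ≤ m' ∧ m' < a + n := by
  have hn : (0 : ℤ) < n := by exact_mod_cast Nat.pos_of_ne_zero (NeZero.ne n)
  refine ⟨a + (m - a) % n, -((m - a) / n), ?_, ?_, ?_⟩
  · linarith [Int.emod_add_mul_ediv (m - a) n, mul_comm ((n : ℤ)) ((m - a) / n)]
  · linarith [Int.emod_nonneg (m - a) hn.ne']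
  · linarith [Int.emod_lt_of_pos (m - a) hn]

open Fin.CommRing in
theorem vtx_add_mul_period (P : Polygon Plane n) (m c : ℤ) : P.vtx (m + c * n) = P.vtx m := by
  unfold vtx
  congr 1
  exact (CharP.intCast_eq_intCast (Fin n) n).2 (by simp)

open Fin.CommRing in
theorem vtx_finRotate (P : Polygon Plane n) (m : ℤ) :
    P (finRotate n (m : Fin n)) = P.vtx (m + 1) := by
  rw [finRotate_apply, vtx]; push_cast; rfl

open Fin.CommRing in
theorem vtx_finRotate_symm (P : Polygon Plane n) (m : ℤ) :
    P ((finRotate n).symm (m : Fin n)) = P.vtx (m - 1) := by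
  rw [finRotate_symm_apply, vtx]; push_cast; rfl

open Fin.CommRing in
theorem mem_edgeSet_intCast {m : ℤ} {x : Plane} :
    x ∈ P.edgeSet ℝ (m : Fin n) ↔
      ∃ t ∈ Set.Icc (0 : ℝ) 1, AffineMap.lineMap (P.vtx m) (P.vtx (m + 1)) t = x := by
  rw [edgeSet, vtx_finRotate, ← vtx]; rfl

open Fin.CommRing in
theorem intCast_ne {a b : ℤ} (hab : a < b) (hba : b < a + n) : (a : Fin n) ≠ (b : Fin n) := by
  intro h
  rw [CharP.intCast_eq_intCast (Fin n) n] at h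
  obtain ⟨c, hc⟩ := h.dvd
  have hc0 : 0 < c := by
    by_contra! h0
    nlinarith
  nlinarith

namespace IsConvexCCW

open Fin.CommRing in
theorem signedArea_edge_pos (hP : P.IsConvexCCW) {m j : ℤ} (h1 : m + 1 < j) (h2 : j < m + n) :
    0 < signedArea (P.vtx m) (P.vtx (m + 1)) (P.vtx j) := by
  rw [← vtx_finRotate]
  apply hP.left_of_edge
  · exact (intCast_ne (by linarith) h2).symm
  · rw [finRotate_apply]
    have := (intCast_ne h1 (show j < m + 1 + n by linarith)).symm
    push_cast at this
    exact this

/-- Any three vertices in counterclockwise order span a positively oriented triangle. -/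
theorem signedArea_pos (hP : P.IsConvexCCW) {a b c : ℤ} (hab : a < b) (hbc : b < c)
    (hca : c < a + n) : 0 < signedArea (P.vtx a) (P.vtx b) (P.vtx c) := by
  obtain ⟨d, rfl⟩ : ∃ d : ℕ, c = b + 1 + d := ⟨(c - (b + 1)).toNat, by omega⟩
  induction d with
  | zero =>
    rw [signedArea_rotate, ← vtx_add_period P a]
    simpa using hP.signedArea_edge_pos (m := b) (j := a + n) (by push_cast at hca; linarith)
      (by linarith)
  | succ d ih =>
    have h1 := ih (by linarith) (by push_cast at hca; linarith)
    have h2 : 0 < signedArea (P.vtx a) (P.vtx (b + 1 + d)) (P.vtx (b + 1 + d + 1)) := by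
      rw [signedArea_rotate, ← vtx_add_period P a]
      exact hP.signedArea_edge_pos (by push_cast at hca; linarith) (by linarith)
    rw [show b + 1 + ((d + 1 : ℕ) : ℤ) = b + 1 + d + 1 by push_cast; ring] at hca ⊢
    have e1 := hP.signedArea_edge_pos (m := a) (j := b + 1 + d) (by omega) (by omega)
    have e2 := hP.signedArea_edge_pos (m := a) (j := b + 1 + d + 1) (by omega) (by omega)
    rcases eq_or_lt_of_le (show a + 1 ≤ b by omega) with rfl | hb
    · exact e2
    have e0 := hP.signedArea_edge_pos (m := a) (j := b) (by omega) (by omega)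
    -- Plücker relation for the directions from vertex `a` to `a + 1`, `b`, `c` and `c + 1`
    have key : signedArea (P.vtx a) (P.vtx (a + 1)) (P.vtx (b + 1 + d)) *
          signedArea (P.vtx a) (P.vtx b) (P.vtx (b + 1 + d + 1))
        = signedArea (P.vtx a) (P.vtx (a + 1)) (P.vtx b) *
            signedArea (P.vtx a) (P.vtx (b + 1 + d)) (P.vtx (b + 1 + d + 1))
          + signedArea (P.vtx a) (P.vtx (a + 1)) (P.vtx (b + 1 + d + 1)) *
            signedArea (P.vtx a) (P.vtx b) (P.vtx (b + 1 + d)) := by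
      unfold signedArea; ring
    exact pos_of_mul_pos_right (key ▸ by positivity) e1.le

theorem vtx_ne (hP : P.IsConvexCCW) {a b : ℤ} (hab : a < b) (hba : b < a + n) :
    P.vtx a ≠ P.vtx b := by
  have h3 := hP.three_le_cast
  rcases eq_or_lt_of_le (show a + 1 ≤ b by omega) with rfl | hb
  · exact ne_of_signedArea_ne_zero_left
      (hP.signedArea_pos (a := a) (b := a + 1) (c := a + 2) (by omega) (by omega) (by omega)).ne'
  · exact ne_of_signedArea_ne_zero_right
      (hP.signedArea_pos (a := a) (b := a + 1) (c := b) (by omega) (by omega) (by omega)).ne'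

end IsConvexCCW

/-! ### Stable vertices -/

/-- A particle at vertex `m` cannot move away from `w`: the vertex makes acute angles with `w` and
each of the two neighbouring vertices. -/
def IsStable (P : Polygon Plane n) (w : Plane) (m : ℤ) : Prop :=
  0 < dotAt (P.vtx m) w (P.vtx (m + 1)) ∧ 0 < dotAt (P.vtx m) w (P.vtx (m - 1))

theorem isStable_add_mul_period {w : Plane} {m c : ℤ} :
    P.IsStable w (m + c * n) ↔ P.IsStable w m := by
  unfold IsStable
  rw [add_right_comm, add_sub_right_comm]
  simp only [vtx_add_mul_period]

theorem isStable_sub_period {w : Plane} {m : ℤ} : P.IsStable w (m - n) ↔ P.IsStable w m := by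
  have := isStable_add_mul_period (P := P) (w := w) (m := m) (c := -1)
  rwa [neg_one_mul, ← sub_eq_add_neg] at this

theorem not_isStable_self (m : ℤ) : ¬ P.IsStable (P.vtx m) m := by
  rintro ⟨h, -⟩
  simp [dotAt] at h

theorem IsStable.ne {m : ℤ} {w : Plane} (h : P.IsStable w m) : P.vtx m ≠ w := by
  rintro rfl; exact not_isStable_self m h

namespace IsConvexCCW

/-- If a vertex is stable with respect to another one, it sees this vertex at an acute angle with
every vertex, not only with its neighbours. -/
theorem dotAt_pos_of_isStable (hP : P.IsConvexCCW) {l m i : ℤ} (h : P.IsStable (P.vtx l) m)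
    (hl : m < l) (hl' : l < m + n) (hi : m < i) (hi' : i < m + n) :
    0 < dotAt (P.vtx m) (P.vtx l) (P.vtx i) := by
  have h3 := hP.three_le_cast
  rcases lt_trichotomy i l with hil | rfl | hil
  · rcases eq_or_lt_of_le (show m + 1 ≤ i by omega) with rfl | hmi
    · exact h.1
    rw [dotAt_comm]
    exact dotAt_pos_of_cone_right (hP.signedArea_pos (b := m + 1) (by omega) (by omega) hl')
      (hP.signedArea_pos (by omega) hmi hi') (hP.signedArea_pos hi hil hl').le
      ((dotAt_comm _ _ _).trans_ge h.1.le)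
  · exact dotAt_self_pos (hP.vtx_ne hl hl')
  · have h2 := h.2
    rw [← vtx_add_period P (m - 1)] at h2
    rcases eq_or_lt_of_le (show i ≤ m - 1 + n by omega) with rfl | hmi
    · exact h2
    exact dotAt_pos_of_cone_left (hP.signedArea_pos hl (by omega) (by omega))
      (hP.signedArea_pos hl hil hi').le (hP.signedArea_pos hi hmi (by omega)) h2.le

/-- If the vertices `v` and `w` are stable with respect to the vertex `a`, which sees them at an
angle that is not obtuse, then the chain from `v` to `w` is seen at obtuse angles from all the
vertices between them. -/
theorem dotAt_neg_of_between (hP : P.IsConvexCCW) {a v i w : ℤ} (hv : P.IsStable (P.vtx a) v)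
    (hw : P.IsStable (P.vtx a) w) (hav : a < v) (hvi : v < i) (hiw : i < w) (hwa : w < a + n)
    (ho : 0 ≤ dotAt (P.vtx a) (P.vtx v) (P.vtx w)) :
    dotAt (P.vtx i) (P.vtx v) (P.vtx w) < 0 := by
  refine dotAt_neg_of_quadrilateral (o := P.vtx a) (hP.signedArea_pos hav (by omega) hwa)
    (hP.signedArea_pos hav hvi (by omega)) (hP.signedArea_pos (by omega) hiw hwa)
    (hP.signedArea_pos hvi hiw (by omega)) ho ?_ ?_
  · rw [← vtx_add_period P a] at hv ⊢
    exact hP.dotAt_pos_of_isStable hv (by omega) (by omega) (by omega) (by omega)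
  · rw [← vtx_add_period P a] at hw ⊢
    rw [← vtx_add_period P i]
    exact hP.dotAt_pos_of_isStable hw (by omega) (by omega) (by omega) (by omega)

/-- An actuator at vertex `v` would drive a particle at vertex `i` on to vertex `i + 1`; the strict
inequality allows the actuator to be moved a little. -/
theorem dotAt_succ_neg_of_between (hP : P.IsConvexCCW) {a v i w : ℤ}
    (hv : P.IsStable (P.vtx a) v)
    (hw : P.IsStable (P.vtx a) w) (hav : a < v) (hvi : v < i) (hiw : i < w) (hwa : w < a + n)
    (ho : 0 ≤ dotAt (P.vtx a) (P.vtx v) (P.vtx w)) :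
    dotAt (P.vtx i) (P.vtx v) (P.vtx (i + 1)) < 0 := by
  have h := hP.dotAt_neg_of_between hv hw hav hvi hiw hwa ho
  rcases eq_or_lt_of_le (show i + 1 ≤ w by omega) with rfl | hi
  · exact h
  by_contra! h'
  refine h.not_gt ?_
  rw [← vtx_add_period P v, dotAt_comm] at h' ⊢
  exact dotAt_pos_of_cone_right (hP.signedArea_pos (by omega) (by omega) (by omega))
      (hP.signedArea_pos (by omega) hi (by omega))
      (hP.signedArea_pos hiw (by omega) (by omega)).le h'

/-- An actuator at vertex `w` would drive a particle at vertex `i` back to vertex `i - 1`; the strict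
inequality allows the actuator to be moved a little. -/
theorem dotAt_pred_neg_of_between (hP : P.IsConvexCCW) {a v i w : ℤ}
    (hv : P.IsStable (P.vtx a) v)
    (hw : P.IsStable (P.vtx a) w) (hav : a < v) (hvi : v < i) (hiw : i < w) (hwa : w < a + n)
    (ho : 0 ≤ dotAt (P.vtx a) (P.vtx v) (P.vtx w)) :
    dotAt (P.vtx i) (P.vtx w) (P.vtx (i - 1)) < 0 := by
  have h := hP.dotAt_neg_of_between hv hw hav hvi hiw hwa ho
  rw [dotAt_comm] at h
  rcases eq_or_lt_of_le (show v ≤ i - 1 by omega) with rfl | hi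
  · exact h
  by_contra! h'
  refine h.not_gt ?_
  rw [← vtx_add_period P (i - 1)] at h'
  rw [← vtx_add_period P v]
  exact dotAt_pos_of_cone_left (hP.signedArea_pos hiw (by omega) (by omega))
      (hP.signedArea_pos (by omega) (by omega) (by omega)).le
      (hP.signedArea_pos (by omega) (by omega) (by omega)) h'

/-! ### The first actuator -/

/-- Suppose that from every vertex some two vertices that are stable with respect to it are seen at
an obtuse angle. If one of `x`, `y` is stable with respect to the other, it lies between such a
pair, and this gives a shorter chain whose ends have the same property; so there is no such pair
`x`, `y`. -/
theorem not_isStable_of_forall_obtuse (hP : P.IsConvexCCW)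
    (hbad : ∀ a : ℤ, ∃ v w : ℤ, a < v ∧ v < w ∧ w < a + n ∧ P.IsStable (P.vtx a) v ∧
      P.IsStable (P.vtx a) w ∧ dotAt (P.vtx a) (P.vtx v) (P.vtx w) < 0)
    (x y : ℤ) (hxy : x < y) (hyx : y < x + n) :
    ¬ (P.IsStable (P.vtx x) y ∨ P.IsStable (P.vtx y) x) := by
  -- the vertex `l` lies strictly between the pair belonging to `m`
  have main : ∀ m l v w : ℤ, P.IsStable (P.vtx l) m → m < l → l < m + n → m < v → v < w →
      w < m + n → dotAt (P.vtx m) (P.vtx v) (P.vtx w) < 0 → v < l ∧ l < w := by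
    intro m l v w hm hl hl' hv hvw hw hneg
    constructor
    · by_contra! h
      refine hneg.not_gt ?_
      have h1 := hP.dotAt_pos_of_isStable hm hl hl' (i := w) (by omega) hw
      rcases eq_or_lt_of_le h with rfl | h
      · exact h1
      exact dotAt_pos_of_cone_right (hP.signedArea_pos hl (by omega) hw)
        (hP.signedArea_pos hl h (by omega)) (hP.signedArea_pos hv hvw hw).le h1.le
    · by_contra! h
      refine hneg.not_gt ?_
      have h1 := hP.dotAt_pos_of_isStable hm hl hl' (i := v) hv (by omega)
      rw [dotAt_comm] at h1
      rcases eq_or_lt_of_le h with rfl | h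
      · exact h1
      exact dotAt_pos_of_cone_left (hP.signedArea_pos hv (by omega) hl')
        (hP.signedArea_pos hv hvw hw).le (hP.signedArea_pos (by omega) h hl') h1.le
  rintro (h | h)
  · obtain ⟨v, w, hv, hvw, hw, -, hws, hneg⟩ := hbad y
    rw [← vtx_add_period P x] at h
    obtain ⟨-, h2⟩ := main y (x + n) v w h (by omega) (by omega) hv hvw hw hneg
    exact not_isStable_of_forall_obtuse hP hbad (w - n) y (by omega) (by omega)
      (Or.inr (isStable_sub_period.2 hws))
  · obtain ⟨v, w, hv, hvw, hw, hvs, -, hneg⟩ := hbad x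
    obtain ⟨h1, -⟩ := main x y v w h hxy hyx hv hvw hw hneg
    exact not_isStable_of_forall_obtuse hP hbad x v hv (by omega) (Or.inl hvs)
  termination_by (y - x).toNat

end IsConvexCCW

end Polygon

namespace Polygon

/-! ### Single steps -/

theorem eq_vtx_of_step {n : ℕ} {P : Polygon Plane n} {w x y : Plane} (hx : x ∈ P.boundary ℝ)
    (h : P.Step w x y) :
    ∃ i : Fin n, y = P i := by
  cases h with
  | inside _ _ hx' _ _ _ => exact absurd hx hx'
  | ccw h => obtain ⟨i, -, rfl, -⟩ := h; exact ⟨_, rfl⟩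
  | cw h _ => obtain ⟨i, -, rfl, -⟩ := h; exact ⟨_, rfl⟩

theorem exists_step_of_canMoveCW {n : ℕ} {P : Polygon Plane n} {w x y : Plane}
    (h : P.CanMoveCW w x y) : ∃ z, P.Step w x z := by
  by_cases h' : ∃ z, P.StepCCW w x z
  · obtain ⟨z, hz⟩ := h'
    exact ⟨z, Step.ccw x z hz⟩
  · exact ⟨y, Step.cw x y h (not_exists.1 h')⟩

theorem dist_lt_of_step {n : ℕ} {P : Polygon Plane n} {w x y : Plane} (hxw : x ≠ w)
    (h : P.Step w x y) : dist w x < dist w y := by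
  cases h with
  | inside t _ _ _ ht hxy =>
    have h0 := dotAt_self_pos hxw.symm
    rw [dist_lt_dist_iff_dotAt]
    have : dotAt w y y = (1 + t) ^ 2 * dotAt w x x := by
      rw [hxy]
      simp only [dotAt, PiLp.add_apply, PiLp.smul_apply, PiLp.sub_apply, smul_eq_mul]
      ring
    rw [this]
    nlinarith [mul_pos ht h0, mul_pos (mul_pos ht ht) h0]
  | ccw h => obtain ⟨_, _, _, _, h⟩ := h; exact h.dist_lt
  | cw h _ => obtain ⟨_, _, _, _, h⟩ := h; exact h.dist_lt

theorem ComesToRest.of_reflTransGen {n : ℕ} {P : Polygon Plane n} {w x y a : Plane}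
    (h : Relation.ReflTransGen (P.Step w) x y)
    (h' : P.ComesToRest w y a) : P.ComesToRest w x a :=
  ⟨h.trans h'.1, h'.2⟩

variable {n : ℕ} [NeZero n] {P : Polygon Plane n}

/-! ### The region and its boundary -/

namespace IsConvexCCW

theorem signedArea_nonneg_of_mem_region (hP : P.IsConvexCCW) {x : Plane} (hx : x ∈ P.region)
    (m : ℤ) : 0 ≤ signedArea (P.vtx m) (P.vtx (m + 1)) x := by
  have hconv : Convex ℝ {y : Plane | 0 ≤ signedArea (P.vtx m) (P.vtx (m + 1)) y} := by
    intro y hy z hz s t hs ht hst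
    simp only [Set.mem_ofPred_eq] at hy hz ⊢
    have : signedArea (P.vtx m) (P.vtx (m + 1)) (s • y + t • z)
        = s * signedArea (P.vtx m) (P.vtx (m + 1)) y
          + t * signedArea (P.vtx m) (P.vtx (m + 1)) z := by
      obtain rfl : s = 1 - t := by linarith
      simp only [signedArea, PiLp.add_apply, PiLp.smul_apply, smul_eq_mul]
      ring
    rw [this]; positivity
  refine convexHull_min ?_ hconv hx
  rintro _ ⟨i, rfl⟩
  obtain ⟨j, hj, hj', h⟩ := exists_vtx_eq P i m
  rw [Set.mem_ofPred_eq, ← h]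
  rcases eq_or_lt_of_le hj with rfl | hj
  · simp [signedArea]
  rcases eq_or_lt_of_le (show m + 1 ≤ j by omega) with rfl | hj
  · unfold signedArea; linarith
  · exact (hP.signedArea_edge_pos hj hj').le

/-- A point on the line through an edge and on the inner side of both neighbouring edges lies on
the edge. -/
theorem exists_lineMap_eq (hP : P.IsConvexCCW) {m : ℤ} {y : Plane}
    (h0 : signedArea (P.vtx m) (P.vtx (m + 1)) y = 0)
    (h1 : 0 ≤ signedArea (P.vtx (m - 1)) (P.vtx m) y)
    (h2 : 0 ≤ signedArea (P.vtx (m + 1)) (P.vtx (m + 2)) y) :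
    ∃ t ∈ Set.Icc (0 : ℝ) 1, AffineMap.lineMap (P.vtx m) (P.vtx (m + 1)) t = y := by
  have h3 := hP.three_le_cast
  have d1 := hP.signedArea_pos (a := m - 1) (b := m) (c := m + 1) (by omega) (by omega) (by omega)
  have d2 := hP.signedArea_pos (a := m) (b := m + 1) (c := m + 2) (by omega) (by omega) (by omega)
  obtain ⟨t, ht⟩ : ∃ t, t = signedArea (P.vtx (m - 1)) (P.vtx m) y /
    signedArea (P.vtx (m - 1)) (P.vtx m) (P.vtx (m + 1)) := ⟨_, rfl⟩
  have ht' : t * signedArea (P.vtx (m - 1)) (P.vtx m) (P.vtx (m + 1))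
      = signedArea (P.vtx (m - 1)) (P.vtx m) y := by rw [ht, div_mul_cancel₀ _ d1.ne']
  have hy : AffineMap.lineMap (P.vtx m) (P.vtx (m + 1)) t = y := by
    apply Plane.ext <;> rw [lineMap_coord] <;> apply mul_left_cancel₀ d1.ne'
    · unfold signedArea at ht' h0 ⊢
      linear_combination (P.vtx (m + 1) 0 - P.vtx m 0) * ht'
        + (P.vtx m 0 - P.vtx (m - 1) 0) * h0
    · unfold signedArea at ht' h0 ⊢
      linear_combination (P.vtx (m + 1) 1 - P.vtx m 1) * ht'
        + (P.vtx m 1 - P.vtx (m - 1) 1) * h0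
  refine ⟨t, ⟨by rw [ht]; positivity, ?_⟩, hy⟩
  have : signedArea (P.vtx (m + 1)) (P.vtx (m + 2)) y
      = (1 - t) * signedArea (P.vtx m) (P.vtx (m + 1)) (P.vtx (m + 2)) := by
    rw [← hy]; unfold signedArea; simp only [lineMap_coord]; ring
  rw [this] at h2
  linarith [nonneg_of_mul_nonneg_left h2 d2]

end IsConvexCCW

theorem mem_boundary_iff {x : Plane} :
    x ∈ P.boundary ℝ ↔
      ∃ m : ℤ, ∃ t ∈ Set.Icc (0 : ℝ) 1, AffineMap.lineMap (P.vtx m) (P.vtx (m + 1)) t = x := by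
  rw [boundary, Set.mem_iUnion]
  constructor
  · rintro ⟨i, hi⟩
    obtain ⟨m, -, -, rfl⟩ := exists_intCast_fin i 0
    exact ⟨m, mem_edgeSet_intCast.1 hi⟩
  · rintro ⟨m, hm⟩
    exact ⟨_, mem_edgeSet_intCast.2 hm⟩

theorem vtx_mem_boundary (P : Polygon Plane n) (m : ℤ) : P.vtx m ∈ P.boundary ℝ :=
  mem_boundary_iff.2 ⟨m, 0, by simp, by simp⟩

theorem vtx_mem_region (P : Polygon Plane n) (m : ℤ) : P.vtx m ∈ P.region :=
  subset_convexHull ℝ _ ⟨_, rfl⟩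

theorem lineMap_vtx_mem_region (P : Polygon Plane n) (l m : ℤ) {t : ℝ}
    (ht : t ∈ Set.Icc (0 : ℝ) 1) :
    AffineMap.lineMap (P.vtx l) (P.vtx m) t ∈ P.region :=
  (convex_convexHull ℝ _).lineMap_mem (vtx_mem_region P l) (vtx_mem_region P m) ht

namespace IsConvexCCW

theorem signedArea_pos_of_notMem_boundary (hP : P.IsConvexCCW) {x : Plane} (hx : x ∈ P.region)
    (hx' : x ∉ P.boundary ℝ) (m : ℤ) : 0 < signedArea (P.vtx m) (P.vtx (m + 1)) x := by
  refine lt_of_le_of_ne (hP.signedArea_nonneg_of_mem_region hx m) fun h => hx' ?_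
  refine mem_boundary_iff.2 ⟨m, hP.exists_lineMap_eq h.symm ?_ ?_⟩
  · simpa using hP.signedArea_nonneg_of_mem_region hx (m - 1)
  · simpa [add_assoc] using hP.signedArea_nonneg_of_mem_region hx (m + 1)

theorem vtx_mem_edge (hP : P.IsConvexCCW) {l m : ℤ} (hm : l ≤ m) (hm' : m < l + n) {t : ℝ}
    (h : AffineMap.lineMap (P.vtx l) (P.vtx (l + 1)) t = P.vtx m) : m = l ∨ m = l + 1 := by
  by_contra! hne
  refine (hP.signedArea_edge_pos (m := l) (j := m) (by omega) hm').ne' ?_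
  rw [← h]
  unfold signedArea; simp only [lineMap_coord]; ring

/-- A particle that moves straight in direction `v` approaches the line through some edge:
otherwise the signed distance from the axis `ℝ • v` would be monotone along the periodic sequence
of the vertices. -/
theorem exists_signedArea_neg (hP : P.IsConvexCCW) {v : Plane} (hv : v ≠ 0) :
    ∃ m : ℤ, (P.vtx (m + 1) 0 - P.vtx m 0) * v 1 - (P.vtx (m + 1) 1 - P.vtx m 1) * v 0 < 0 := by
  by_contra! h
  have h3 := hP.three_le_cast
  have hle : ∀ m : ℤ, P.vtx m 0 * v 1 - P.vtx m 1 * v 0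
      ≤ P.vtx (m + 1) 0 * v 1 - P.vtx (m + 1) 1 * v 0 := fun m => by linarith [h m]
  have hmono : Monotone fun m : ℤ => P.vtx m 0 * v 1 - P.vtx m 1 * v 0 :=
    monotone_int_of_le_succ hle
  -- a monotone periodic sequence is constant
  have hconst : ∀ m : ℤ, 0 ≤ m → m ≤ n →
      P.vtx m 0 * v 1 - P.vtx m 1 * v 0 = P.vtx 0 0 * v 1 - P.vtx 0 1 * v 0 := by
    intro m h0 hm
    refine le_antisymm ?_ (hmono h0)
    have := hmono hm
    simp only at this
    rwa [← zero_add (n : ℤ), vtx_add_period] at this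
  have e1 := hconst 1 (by omega) (by omega)
  have e2 := hconst 2 (by omega) (by omega)
  have d := hP.signedArea_pos (a := 0) (b := 1) (c := 2) (by omega) (by omega) (by omega)
  unfold signedArea at d
  apply hv
  apply Plane.ext <;> apply mul_left_cancel₀ d.ne' <;> simp only [PiLp.zero_apply, mul_zero]
  · linear_combination (P.vtx 2 0 - P.vtx 0 0) * e1 - (P.vtx 1 0 - P.vtx 0 0) * e2
  · linear_combination (P.vtx 2 1 - P.vtx 0 1) * e1 - (P.vtx 1 1 - P.vtx 0 1) * e2

/-- A particle inside the polygon reaches the boundary. -/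
theorem exists_step_of_notMem_boundary (hP : P.IsConvexCCW) {w x : Plane} (hx : x ∈ P.region)
    (hx' : x ∉ P.boundary ℝ) (hxw : x ≠ w) : ∃ y, P.Step w x y := by
  obtain ⟨f, hf⟩ : ∃ f : ℤ → ℝ, ∀ m, f m = signedArea (P.vtx m) (P.vtx (m + 1)) x :=
    ⟨_, fun _ => rfl⟩
  obtain ⟨g, hg⟩ : ∃ g : ℤ → ℝ, ∀ m, g m = (P.vtx (m + 1) 0 - P.vtx m 0) * (x - w) 1
      - (P.vtx (m + 1) 1 - P.vtx m 1) * (x - w) 0 := ⟨_, fun _ => rfl⟩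
  have hfpos : ∀ m, 0 < f m := fun m => hf m ▸ hP.signedArea_pos_of_notMem_boundary hx hx' m
  have hfg : ∀ (m : ℤ) (t : ℝ),
      signedArea (P.vtx m) (P.vtx (m + 1)) (x + t • (x - w)) = f m + t * g m := by
    intro m t
    rw [hf, hg]
    simp only [signedArea, PiLp.add_apply, PiLp.smul_apply, PiLp.sub_apply, smul_eq_mul]
    ring
  have hper : ∀ m c : ℤ, f (m + c * n) = f m ∧ g (m + c * n) = g m := by
    intro m c
    rw [hf, hf, hg, hg, add_right_comm]
    simp only [vtx_add_mul_period, and_self]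
  -- the first line through an edge that the particle meets
  obtain ⟨m, hm, hmin⟩ : ∃ m, g m < 0 ∧ ∀ l, g l < 0 → f m / -g m ≤ f l / -g l := by
    obtain ⟨m₀, hm₀⟩ := hP.exists_signedArea_neg (sub_ne_zero.2 hxw)
    rw [← hg] at hm₀
    obtain ⟨m₁, c, h1, h2, h3⟩ := exists_add_mul_period n m₀ 0
    have hne : ((Finset.Ico (0 : ℤ) (0 + n)).filter fun m => g m < 0).Nonempty :=
      ⟨m₁, by simp only [Finset.mem_filter, Finset.mem_Ico]; exact ⟨⟨h2, h3⟩, by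
        rw [h1, (hper _ _).2]; exact hm₀⟩⟩
    obtain ⟨m, hm, hmin⟩ := Finset.exists_min_image _ (fun m => f m / -g m) hne
    refine ⟨m, (Finset.mem_filter.1 hm).2, fun l hl => ?_⟩
    obtain ⟨l₁, c, h1, h2, h3⟩ := exists_add_mul_period n l 0
    have := hmin l₁ (by
      simp only [Finset.mem_filter, Finset.mem_Ico]
      exact ⟨⟨h2, h3⟩, by rw [h1, (hper _ _).2]; exact hl⟩)
    rwa [h1, (hper _ _).1, (hper _ _).2] at this
  have ht : 0 < f m / -g m := div_pos (hfpos m) (by linarith)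
  have hnonneg : ∀ l,
      0 ≤ signedArea (P.vtx l) (P.vtx (l + 1)) (x + (f m / -g m) • (x - w)) := by
    intro l
    rw [hfg]
    rcases le_or_gt 0 (g l) with h | h
    · have := hfpos l
      positivity
    · have := hmin l h
      rw [le_div_iff₀ (by linarith)] at this
      linarith
  refine ⟨_, Step.inside x _ (f m / -g m) hx hx' ?_ ht rfl⟩
  refine mem_boundary_iff.2 ⟨m, hP.exists_lineMap_eq ?_ ?_ ?_⟩
  · rw [hfg]
    rw [div_neg, neg_mul, div_mul_cancel₀ _ hm.ne, add_neg_cancel]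
  · simpa using hnonneg (m - 1)
  · simpa [add_assoc] using hnonneg (m + 1)

end IsConvexCCW

/-! ### Movement along the boundary -/

theorem stepCCW_iff {w x y : Plane} : P.StepCCW w x y ↔
    ∃ m : ℤ, (∃ t ∈ Set.Icc (0 : ℝ) 1, AffineMap.lineMap (P.vtx m) (P.vtx (m + 1)) t = x) ∧
      y = P.vtx (m + 1) ∧ x ≠ y ∧ MovesAway w x y := by
  constructor
  · rintro ⟨i, hi, hy, h⟩
    obtain ⟨m, -, -, rfl⟩ := exists_intCast_fin i 0
    exact ⟨m, mem_edgeSet_intCast.1 hi, hy.trans (vtx_finRotate P m), h⟩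
  · rintro ⟨m, hm, hy, h⟩
    exact ⟨_, mem_edgeSet_intCast.2 hm, hy.trans (vtx_finRotate P m).symm, h⟩

theorem canMoveCW_iff {w x y : Plane} : P.CanMoveCW w x y ↔
    ∃ m : ℤ, (∃ t ∈ Set.Icc (0 : ℝ) 1, AffineMap.lineMap (P.vtx m) (P.vtx (m + 1)) t = x) ∧
      y = P.vtx m ∧ x ≠ y ∧ MovesAway w x y := by
  constructor
  · rintro ⟨i, hi, hy, h⟩
    obtain ⟨m, -, -, rfl⟩ := exists_intCast_fin i 0
    exact ⟨m, mem_edgeSet_intCast.1 hi, hy, h⟩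
  · rintro ⟨m, hm, hy, h⟩
    exact ⟨_, mem_edgeSet_intCast.2 hm, hy, h⟩

theorem mem_boundary_of_step {w x y : Plane} (h : P.Step w x y) : y ∈ P.boundary ℝ := by
  cases h with
  | inside _ _ _ hy _ _ => exact hy
  | ccw h => obtain ⟨m, -, rfl, -⟩ := stepCCW_iff.1 h; exact vtx_mem_boundary P _
  | cw h _ => obtain ⟨m, -, rfl, -⟩ := canMoveCW_iff.1 h; exact vtx_mem_boundary P _

/-- Every particle on the boundary comes to rest, since its successive positions after the first
one are vertices whose distances from the actuator increase. -/
theorem exists_comesToRest_of_mem_boundary (P : Polygon Plane n) {w x : Plane}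
    (hx : x ∈ P.boundary ℝ) (hxw : x ≠ w) : ∃ a, P.ComesToRest w x a := by
  induction hk : (Finset.univ.filter fun i : Fin n => dist w x < dist w (P i)).card
    using Nat.strong_induction_on generalizing x with
  | _ k ih =>
    subst hk
    by_cases hs : ∃ y, P.Step w x y
    · obtain ⟨y, hy⟩ := hs
      have hlt := dist_lt_of_step hxw hy
      obtain ⟨i, rfl⟩ := eq_vtx_of_step hx hy
      have hne : P i ≠ w := by
        intro h
        rw [h, dist_self] at hlt
        exact hlt.not_ge dist_nonneg
      obtain ⟨a, ha⟩ := ih _ (Finset.card_lt_card (by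
        rw [Finset.ssubset_iff_of_subset]
        · exact ⟨i, by simpa using hlt, by simp⟩
        · intro j hj
          simp only [Finset.mem_filter, Finset.mem_univ, true_and] at hj ⊢
          exact hlt.trans hj)) (mem_boundary_of_step hy) hne rfl
      exact ⟨a, ha.of_reflTransGen (.single hy)⟩
    · exact ⟨x, .refl, not_exists.1 hs⟩

namespace IsConvexCCW

theorem exists_comesToRest (hP : P.IsConvexCCW) {w x : Plane} (hx : x ∈ P.region) (hxw : x ≠ w) :
    ∃ a, P.ComesToRest w x a := by
  by_cases hx' : x ∈ P.boundary ℝ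
  · exact exists_comesToRest_of_mem_boundary P hx' hxw
  · obtain ⟨y, hy⟩ := hP.exists_step_of_notMem_boundary hx hx' hxw
    have hlt := dist_lt_of_step hxw hy
    have hne : y ≠ w := by
      rintro rfl
      rw [dist_self] at hlt
      exact hlt.not_ge dist_nonneg
    obtain ⟨a, ha⟩ := exists_comesToRest_of_mem_boundary P (mem_boundary_of_step hy) hne
    exact ⟨a, ha.of_reflTransGen (.single hy)⟩

theorem stepCCW_vtx (hP : P.IsConvexCCW) {w : Plane} {m : ℤ}
    (h : dotAt (P.vtx m) w (P.vtx (m + 1)) ≤ 0) : P.StepCCW w (P.vtx m) (P.vtx (m + 1)) := by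
  have hne := hP.vtx_ne (show m < m + 1 by omega) (by linarith [hP.three_le_cast])
  exact stepCCW_iff.2 ⟨m, ⟨0, by simp, by simp⟩, rfl, hne, movesAway_of_dotAt_nonpos hne h⟩

theorem canMoveCW_vtx (hP : P.IsConvexCCW) {w : Plane} {m : ℤ}
    (h : dotAt (P.vtx m) w (P.vtx (m - 1)) ≤ 0) : P.CanMoveCW w (P.vtx m) (P.vtx (m - 1)) := by
  have hne := (hP.vtx_ne (show m - 1 < m by omega) (by linarith [hP.three_le_cast])).symm
  exact canMoveCW_iff.2 ⟨m - 1, ⟨1, by simp, by simp⟩, rfl, hne, movesAway_of_dotAt_nonpos hne h⟩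

/-- A vertex is not counted as a starting point of the edge that ends there. -/
theorem not_stepCCW_vtx (hP : P.IsConvexCCW) {w z : Plane} {m : ℤ}
    (h : 0 < dotAt (P.vtx m) w (P.vtx (m + 1))) : ¬ P.StepCCW w (P.vtx m) z := by
  intro hz
  obtain ⟨l, ⟨t, -, ht⟩, rfl, hne, hmv⟩ := stepCCW_iff.1 hz
  obtain ⟨m', c, hm', h1, h2⟩ := exists_add_mul_period n m l
  have e1 : P.vtx m = P.vtx m' := by rw [hm', vtx_add_mul_period]
  have e2 : P.vtx (m + 1) = P.vtx (m' + 1) := by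
    rw [hm', add_right_comm, vtx_add_mul_period]
  rw [e1] at ht hne hmv h
  rw [e2] at h
  rcases hP.vtx_mem_edge h1 h2 ht with rfl | rfl
  · exact h.not_ge hmv.dotAt_nonpos
  · exact hne rfl

/-- A particle that is at rest, away from the actuator, is at a stable vertex. -/
theorem exists_isStable_of_forall_not_step (hP : P.IsConvexCCW) {w a : Plane}
    (ha : a ∈ P.boundary ℝ) (haw : a ≠ w) (h : ∀ y, ¬ P.Step w a y) :
    ∃ m, a = P.vtx m ∧ P.IsStable w m := by
  obtain ⟨m, t, ht, rfl⟩ := mem_boundary_iff.1 ha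
  have h3 := hP.three_le_cast
  have vertex : ∀ l : ℤ, (∀ y, ¬ P.Step w (P.vtx l) y) → P.IsStable w l := by
    intro l hl
    constructor
    · by_contra! h'
      exact hl _ (Step.ccw _ _ (hP.stepCCW_vtx h'))
    · by_contra! h'
      obtain ⟨z, hz⟩ := exists_step_of_canMoveCW (hP.canMoveCW_vtx h')
      exact hl z hz
  have hne := hP.vtx_ne (show m < m + 1 by omega) (by omega)
  by_cases h0 : AffineMap.lineMap (P.vtx m) (P.vtx (m + 1)) t = P.vtx m
  · rw [h0] at h ⊢
    exact ⟨m, rfl, vertex m h⟩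
  by_cases h1 : AffineMap.lineMap (P.vtx m) (P.vtx (m + 1)) t = P.vtx (m + 1)
  · rw [h1] at h ⊢
    exact ⟨m + 1, rfl, vertex (m + 1) h⟩
  exfalso
  -- at an inner point of an edge at least one of the two directions leads away from the actuator
  obtain ⟨x, hx⟩ : ∃ x : Plane, x = AffineMap.lineMap (P.vtx m) (P.vtx (m + 1)) t := ⟨_, rfl⟩
  have key : t * dotAt x w (P.vtx (m + 1)) = -((1 - t) * dotAt x w (P.vtx m)) := by
    rw [hx]; simp only [dotAt, lineMap_coord]; ring
  rw [← hx] at h h0 h1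
  by_cases hc : dotAt x w (P.vtx (m + 1)) ≤ 0
  · exact h _ (Step.ccw _ _ (stepCCW_iff.2
      ⟨m, ⟨t, ht, hx.symm⟩, rfl, h1, movesAway_of_dotAt_nonpos h1 hc⟩))
  · have ht0 : t ≠ 0 := by
      rintro rfl
      exact h0 (by rw [hx]; simp)
    have ht1 : t ≠ 1 := by
      rintro rfl
      exact h1 (by rw [hx]; simp)
    have ht0' : 0 < t := lt_of_le_of_ne ht.1 ht0.symm
    have ht1' : 0 < 1 - t := sub_pos.2 (lt_of_le_of_ne ht.2 ht1)
    have hc' : dotAt x w (P.vtx m) ≤ 0 := by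
      have : 0 < t * dotAt x w (P.vtx (m + 1)) := mul_pos ht0' (not_le.1 hc)
      by_contra! hd
      nlinarith [mul_pos ht1' hd]
    obtain ⟨z, hz⟩ := exists_step_of_canMoveCW (canMoveCW_iff.2
      ⟨m, ⟨t, ht, hx.symm⟩, rfl, h0, movesAway_of_dotAt_nonpos h0 hc'⟩)
    exact h z hz

theorem exists_isStable_of_comesToRest (hP : P.IsConvexCCW) {w x a : Plane} (hx : x ∈ P.region)
    (hxw : x ≠ w) (h : P.ComesToRest w x a) : ∃ m, a = P.vtx m ∧ P.IsStable w m := by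
  obtain ⟨hxa, hrest⟩ := h
  have haw : dist w x ≤ dist w a ∧ (a = x ∨ a ∈ P.boundary ℝ) := by
    clear hrest
    induction hxa with
    | refl => exact ⟨le_rfl, Or.inl rfl⟩
    | tail _ hbc ih =>
      have hb : dist w x < dist w _ := ih.1.trans_lt (dist_lt_of_step (by
        rintro rfl
        rw [dist_self] at ih
        exact (dist_pos.2 hxw.symm).not_ge ih.1) hbc)
      exact ⟨hb.le, Or.inr (mem_boundary_of_step hbc)⟩
  have hne : a ≠ w := by
    rintro rfl
    rw [dist_self] at haw
    exact (dist_pos.2 hxw.symm).not_ge haw.1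
  refine hP.exists_isStable_of_forall_not_step ?_ hne hrest
  by_contra hb
  obtain rfl : a = x := haw.2.resolve_right hb
  obtain ⟨y, hy⟩ := hP.exists_step_of_notMem_boundary hx hb hxw
  exact hrest y hy

end IsConvexCCW

end Polygon

namespace Polygon

variable {n : ℕ} [NeZero n] {P : Polygon Plane n}

/-! ### The second actuator -/

theorem tendsto_dotAt_lineMap (o p q b : Plane) :
    Filter.Tendsto (fun t : ℝ => dotAt o (AffineMap.lineMap p q t) b) (nhdsWithin 0 (Set.Ioi 0))
      (nhds (dotAt o p b)) := by
  have h : ∀ t : ℝ, dotAt o (AffineMap.lineMap p q t) b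
      = dotAt o p b + t * (dotAt o q b - dotAt o p b) := by
    intro t; simp only [dotAt, lineMap_coord]; ring
  simp only [h]
  have hc : Continuous fun t : ℝ => dotAt o p b + t * (dotAt o q b - dotAt o p b) := by fun_prop
  have := hc.tendsto 0
  simp only [zero_mul, add_zero] at this
  exact this.mono_left nhdsWithin_le_nhds

open Fin.CommRing in
theorem isAcuteVertex_intCast_iff {m : ℤ} : P.IsAcuteVertex (m : Fin n) ↔
    0 < dotAt (P.vtx m) (P.vtx (m - 1)) (P.vtx (m + 1)) := by
  rw [IsAcuteVertex, angle_lt_pi_div_two_iff_dotAt, vtx_finRotate, vtx_finRotate_symm]; rfl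

namespace IsConvexCCW

theorem lineMap_ne_vtx (hP : P.IsConvexCCW) (m l : ℤ) {t : ℝ} (h0 : 0 < t) (h1 : t < 1) :
    AffineMap.lineMap (P.vtx m) (P.vtx (m + 1)) t ≠ P.vtx l := by
  intro h
  have hinj := AffineMap.lineMap_injective ℝ
    (hP.vtx_ne (show m < m + 1 by omega) (by linarith [hP.three_le_cast]))
  obtain ⟨l', c, hl', hm, hm'⟩ := exists_add_mul_period n l m
  rw [← vtx_add_mul_period P l c, ← hl'] at h
  rcases hP.vtx_mem_edge hm hm' h with rfl | rfl
  · exact h0.ne' (hinj (h.trans (AffineMap.lineMap_apply_zero _ _).symm))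
  · exact h1.ne (hinj (h.trans (AffineMap.lineMap_apply_one _ _).symm))

/-- If the first of two stable vertices is not acute, an actuator on the preceding edge, close to
this vertex, drives all particles of the chain counterclockwise to the second one. -/
theorem exists_actuator_ccw (hP : P.IsConvexCCW) {a v w : ℤ} (hv : P.IsStable (P.vtx a) v)
    (hw : P.IsStable (P.vtx a) w) (hav : a < v) (hwa : w < a + n)
    (ho : 0 ≤ dotAt (P.vtx a) (P.vtx v) (P.vtx w))
    (hobt : dotAt (P.vtx v) (P.vtx (v - 1)) (P.vtx (v + 1)) ≤ 0) :
    ∃ u ∈ P.region, (∀ m, P.vtx m ≠ u) ∧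
      ∀ i, v ≤ i → i ≤ w → Relation.ReflTransGen (P.Step u) (P.vtx i) (P.vtx w) := by
  have hev : ∀ᶠ t : ℝ in nhdsWithin 0 (Set.Ioi 0), ∀ i ∈ Set.Ioo v w,
      dotAt (P.vtx i) (AffineMap.lineMap (P.vtx v) (P.vtx (v - 1)) t) (P.vtx (i + 1)) < 0 := by
    rw [Filter.eventually_all_finite (Set.finite_Ioo v w)]
    intro i hi
    exact (tendsto_dotAt_lineMap _ _ _ _).eventually_lt_const
      (hP.dotAt_succ_neg_of_between hv hw hav hi.1 hi.2 hwa ho)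
  obtain ⟨t, ht, h0, h1⟩ := (hev.and (Ioo_mem_nhdsGT one_pos)).exists
  refine ⟨_, lineMap_vtx_mem_region P v (v - 1) ⟨h0.le, h1.le⟩, fun m => ?_, fun i hvi hiw => ?_⟩
  · have := hP.lineMap_ne_vtx (v - 1) m (sub_pos.2 h1) (sub_lt_self 1 h0)
    rw [sub_add_cancel, AffineMap.lineMap_apply_one_sub] at this
    exact this.symm
  · have hstep : ∀ i, v ≤ i → i < w →
        P.Step (AffineMap.lineMap (P.vtx v) (P.vtx (v - 1)) t) (P.vtx i) (P.vtx (i + 1)) := by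
      intro i hvi hiw
      refine Step.ccw _ _ (hP.stepCCW_vtx ?_)
      rcases eq_or_lt_of_le hvi with rfl | hvi
      · have : dotAt (P.vtx v) (AffineMap.lineMap (P.vtx v) (P.vtx (v - 1)) t) (P.vtx (v + 1))
            = t * dotAt (P.vtx v) (P.vtx (v - 1)) (P.vtx (v + 1)) := by
          simp only [dotAt, lineMap_coord]; ring
        rw [this]
        exact mul_nonpos_of_nonneg_of_nonpos h0.le hobt
      · exact (ht i ⟨hvi, hiw⟩).le
    induction i, hiw using Int.leInductionDown with
    | base => exact .refl
    | pred i hi ih =>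
      have := hstep (i - 1) hvi (by omega)
      rw [sub_add_cancel] at this
      exact .head this (ih (by omega))

/-- If the last of two stable vertices is not acute, an actuator on the following edge, close to
this vertex, drives all particles of the chain clockwise to the first one. -/
theorem exists_actuator_cw (hP : P.IsConvexCCW) {a v w : ℤ} (hv : P.IsStable (P.vtx a) v)
    (hw : P.IsStable (P.vtx a) w) (hav : a < v) (hvw : v < w) (hwa : w < a + n)
    (ho : 0 ≤ dotAt (P.vtx a) (P.vtx v) (P.vtx w))
    (hobt : dotAt (P.vtx w) (P.vtx (w - 1)) (P.vtx (w + 1)) ≤ 0) :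
    ∃ u ∈ P.region, (∀ m, P.vtx m ≠ u) ∧
      ∀ i, v ≤ i → i ≤ w → Relation.ReflTransGen (P.Step u) (P.vtx i) (P.vtx v) := by
  have h3 := hP.three_le_cast
  -- the triangle `i`, `i + 1`, `w` has an obtuse angle at `i + 1`
  have hpos : ∀ i ∈ Set.Ioo v w, 0 < dotAt (P.vtx i) (P.vtx w) (P.vtx (i + 1)) := by
    rintro i ⟨hvi, hiw⟩
    have hsq := dotAt_self_pos (hP.vtx_ne (show i < i + 1 by omega) (by omega))
    rcases eq_or_lt_of_le (show i + 1 ≤ w by omega) with rfl | hi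
    · exact hsq
    have h := hP.dotAt_pred_neg_of_between hv hw hav (i := i + 1) (by omega) hi hwa ho
    rw [add_sub_cancel_right] at h
    unfold dotAt at *
    nlinarith
  have hev : ∀ᶠ t : ℝ in nhdsWithin 0 (Set.Ioi 0), ∀ i ∈ Set.Ioo v w,
      dotAt (P.vtx i) (AffineMap.lineMap (P.vtx w) (P.vtx (w + 1)) t) (P.vtx (i - 1)) < 0 ∧
      0 < dotAt (P.vtx i) (AffineMap.lineMap (P.vtx w) (P.vtx (w + 1)) t) (P.vtx (i + 1)) := by
    rw [Filter.eventually_all_finite (Set.finite_Ioo v w)]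
    intro i hi
    exact ((tendsto_dotAt_lineMap _ _ _ _).eventually_lt_const
      (hP.dotAt_pred_neg_of_between hv hw hav hi.1 hi.2 hwa ho)).and
      ((tendsto_dotAt_lineMap _ _ _ _).eventually_const_lt (hpos i hi))
  obtain ⟨t, ht, h0, h1⟩ := (hev.and (Ioo_mem_nhdsGT one_pos)).exists
  refine ⟨_, lineMap_vtx_mem_region P w (w + 1) ⟨h0.le, h1.le⟩,
    fun m => (hP.lineMap_ne_vtx w m h0 h1).symm, fun i hvi hiw => ?_⟩
  have hstep : ∀ i, v < i → i ≤ w →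
      P.Step (AffineMap.lineMap (P.vtx w) (P.vtx (w + 1)) t) (P.vtx i) (P.vtx (i - 1)) := by
    intro i hvi hiw
    have hscale : ∀ b, dotAt (P.vtx w) (AffineMap.lineMap (P.vtx w) (P.vtx (w + 1)) t) b
        = t * dotAt (P.vtx w) (P.vtx (w + 1)) b := by
      intro b; simp only [dotAt, lineMap_coord]; ring
    refine Step.cw _ _ (hP.canMoveCW_vtx ?_) fun z => hP.not_stepCCW_vtx ?_
    · rcases eq_or_lt_of_le hiw with rfl | hiw
      · rw [hscale, dotAt_comm]
        exact mul_nonpos_of_nonneg_of_nonpos h0.le hobt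
      · exact (ht i ⟨hvi, hiw⟩).1.le
    · rcases eq_or_lt_of_le hiw with rfl | hiw
      · rw [hscale]
        exact mul_pos h0 (dotAt_self_pos (hP.vtx_ne (by omega) (by omega)))
      · exact (ht i ⟨hvi, hiw⟩).2
  induction i, hvi using Int.leInduction with
  | base => exact .refl
  | succ i hi ih =>
    have := hstep (i + 1) (by omega) hiw
    rw [add_sub_cancel_right] at this
    exact .head this (ih (by omega))

/-! ### Gathering with two activations -/

/-- Two activations suffice if the vertex `a` sees the vertices that are stable with respect to it
within a right angle, and no two of these are acute. -/
theorem isGatherable_two (hP : P.IsConvexCCW) (a : ℤ)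
    (hgood : ∀ v w : ℤ, a < v → v < w → w < a + n → P.IsStable (P.vtx a) v →
      P.IsStable (P.vtx a) w → 0 ≤ dotAt (P.vtx a) (P.vtx v) (P.vtx w) ∧
        (dotAt (P.vtx v) (P.vtx (v - 1)) (P.vtx (v + 1)) ≤ 0 ∨
          dotAt (P.vtx w) (P.vtx (w - 1)) (P.vtx (w + 1)) ≤ 0)) :
    P.IsGatherable 2 := by
  have h3 := hP.three_le_cast
  obtain ⟨T, hT⟩ : ∃ T : Set Plane,
      T = {b | ∃ x ∈ P.region \ {P.vtx a}, P.ComesToRest (P.vtx a) x b} := ⟨_, rfl⟩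
  have hrest : ∀ x ∈ P.region \ {P.vtx a}, ∃ b ∈ T, P.ComesToRest (P.vtx a) x b := by
    intro x hx
    obtain ⟨b, hb⟩ := hP.exists_comesToRest hx.1 hx.2
    exact ⟨b, hT ▸ ⟨x, hx, hb⟩, hb⟩
  have hreach : P.Reachable 1 T :=
    Reachable.first (P.vtx a) T (vtx_mem_region P a) ⟨hrest, fun b hb => by rwa [hT] at hb⟩
  have hstable : ∀ b ∈ T, ∃ m, b = P.vtx m ∧ a < m ∧ m < a + n ∧ P.IsStable (P.vtx a) m := by
    intro b hb
    rw [hT] at hb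
    obtain ⟨x, hx, hxb⟩ := hb
    obtain ⟨m, rfl, hm⟩ := hP.exists_isStable_of_comesToRest hx.1 hx.2 hxb
    obtain ⟨m', c, hm', h1, h2⟩ := exists_add_mul_period n m a
    rw [← isStable_add_mul_period (c := c), ← hm'] at hm
    refine ⟨m', by rw [hm', vtx_add_mul_period], lt_of_le_of_ne h1 ?_, h2, hm⟩
    rintro rfl
    exact not_isStable_self _ hm
  have hne : T.Nonempty := by
    obtain ⟨b, hb, -⟩ := hrest (P.vtx (a + 1))
      ⟨vtx_mem_region P _, (hP.vtx_ne (by omega) (by omega)).symm⟩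
    exact ⟨b, hb⟩
  have finish : ∀ u ∈ P.region, u ∉ T → ∀ i : ℤ, P.vtx i ≠ u →
      (∀ b ∈ T, Relation.ReflTransGen (P.Step u) b (P.vtx i)) → P.IsGatherable 2 := by
    intro u hu huT i hi hT'
    obtain ⟨r, hr⟩ := hP.exists_comesToRest (vtx_mem_region P i) hi
    refine ⟨r, Reachable.next 1 u T {r} hreach hu huT ⟨fun x hx => ⟨r, rfl, ?_⟩, ?_⟩⟩
    · exact hr.of_reflTransGen (hT' x hx)
    · rintro _ rfl
      obtain ⟨b, hb⟩ := hne
      exact ⟨b, hb, hr.of_reflTransGen (hT' b hb)⟩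
  -- the first and the last vertex that carry a particle after the first activation
  obtain ⟨J, hJ⟩ : ∃ J : Set ℤ, J = {m | m ∈ Set.Ioo a (a + n) ∧ P.vtx m ∈ T} := ⟨_, rfl⟩
  have hJfin : J.Finite := (Set.finite_Ioo a (a + n)).subset fun m hm => by
    rw [hJ] at hm; exact hm.1
  have hJT : ∀ b ∈ T, ∃ m ∈ J, b = P.vtx m := by
    intro b hb
    obtain ⟨m, rfl, h1, h2, -⟩ := hstable b hb
    exact ⟨m, by rw [hJ]; exact ⟨⟨h1, h2⟩, hb⟩, rfl⟩
  have hJs : ∀ m ∈ J, a < m ∧ m < a + n ∧ P.IsStable (P.vtx a) m := by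
    intro m hm
    rw [hJ] at hm
    obtain ⟨⟨h1, h2⟩, hmT⟩ := hm
    refine ⟨h1, h2, ?_⟩
    obtain ⟨l, hl, h1', h2', hs⟩ := hstable _ hmT
    rcases lt_trichotomy m l with h | rfl | h
    · exact absurd hl (hP.vtx_ne h (by omega))
    · exact hs
    · exact absurd hl.symm (hP.vtx_ne h (by omega))
  have hJne : J.Nonempty := by
    obtain ⟨b, hb⟩ := hne
    obtain ⟨m, hm, -⟩ := hJT b hb
    exact ⟨m, hm⟩
  obtain ⟨v, hvJ, hvmin⟩ := Set.exists_min_image J id hJfin hJne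
  obtain ⟨w, hwJ, hwmax⟩ := Set.exists_max_image J id hJfin hJne
  obtain ⟨hav, -, hvs⟩ := hJs v hvJ
  obtain ⟨-, hwa, hws⟩ := hJs w hwJ
  rcases eq_or_lt_of_le (hvmin w hwJ) with h | hvw
  · -- a single point carries all the particles, and the same actuator does not move them
    refine finish (P.vtx a) (vtx_mem_region P a) ?_ v hvs.ne fun b hb => ?_
    · intro haT
      obtain ⟨m, hm, -, -, hs⟩ := hstable _ haT
      exact hs.ne hm.symm
    · obtain ⟨m, hm, rfl⟩ := hJT b hb
      obtain rfl : v = m := le_antisymm (hvmin m hm) ((hwmax m hm).trans h.ge)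
      exact .refl
  · obtain ⟨ho, hobt⟩ := hgood v w hav hvw hwa hvs hws
    have hend : ∀ i : ℤ, (∃ u ∈ P.region, (∀ m, P.vtx m ≠ u) ∧
        ∀ l, v ≤ l → l ≤ w → Relation.ReflTransGen (P.Step u) (P.vtx l) (P.vtx i)) →
        P.IsGatherable 2 := by
      rintro i ⟨u, hu, hnv, hflow⟩
      refine finish u hu ?_ i (hnv i) fun b hb => ?_
      · intro huT
        obtain ⟨m, -, hm⟩ := hJT u huT
        exact hnv m hm.symm
      · obtain ⟨m, hm, rfl⟩ := hJT b hb
        exact hflow m (hvmin m hm) (hwmax m hm)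
    rcases hobt with h | h
    · exact hend w (hP.exists_actuator_ccw hvs hws hav hwa ho h)
    · exact hend v (hP.exists_actuator_cw hvs hws hav hvw hwa ho h)

/-- An acute vertex sees any two other vertices at an acute angle. -/
theorem dotAt_pos_of_acute (hP : P.IsConvexCCW) {a v w : ℤ}
    (h : 0 < dotAt (P.vtx a) (P.vtx (a - 1)) (P.vtx (a + 1))) (hav : a < v) (hvw : v < w)
    (hwa : w < a + n) : 0 < dotAt (P.vtx a) (P.vtx v) (P.vtx w) := by
  have h3 := hP.three_le_cast
  rw [dotAt_comm, ← vtx_add_period P (a - 1)] at h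
  have h1 : 0 < dotAt (P.vtx a) (P.vtx (a + 1)) (P.vtx w) := by
    rcases eq_or_lt_of_le (show w ≤ a - 1 + n by omega) with rfl | hw
    · exact h
    exact dotAt_pos_of_cone_left (hP.signedArea_pos (by omega) (by omega) (by omega))
      (hP.signedArea_pos (by omega) (by omega) (by omega)).le
      (hP.signedArea_pos (by omega) hw (by omega)) h.le
  rcases eq_or_lt_of_le (show a + 1 ≤ v by omega) with rfl | hv
  · exact h1
  exact dotAt_pos_of_cone_right (hP.signedArea_pos (by omega) (by omega) hwa)
    (hP.signedArea_pos (by omega) hv (by omega)) (hP.signedArea_pos hav hvw hwa).le h1.le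

open Fin.CommRing in
theorem isGatherable_two_of_isAcuteVertex (hP : P.IsConvexCCW)
    (hacute : {i : Fin n | P.IsAcuteVertex i}.ncard ≤ 2) {i : Fin n} (hi : P.IsAcuteVertex i) :
    P.IsGatherable 2 := by
  obtain ⟨a, -, -, rfl⟩ := exists_intCast_fin i 0
  refine hP.isGatherable_two a fun v w hav hvw hwa _ _ =>
    ⟨(hP.dotAt_pos_of_acute (isAcuteVertex_intCast_iff.1 hi) hav hvw hwa).le, ?_⟩
  by_contra! h
  rw [← isAcuteVertex_intCast_iff, ← isAcuteVertex_intCast_iff] at h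
  exact hacute.not_gt ((Set.two_lt_ncard (Set.toFinite _)).2
    ⟨_, hi, _, h.1, _, h.2, intCast_ne hav (by omega), intCast_ne (by omega) hwa,
      intCast_ne hvw (by omega)⟩)

theorem isGatherable_two_of_forall_not_isAcuteVertex (hP : P.IsConvexCCW)
    (h : ∀ i, ¬ P.IsAcuteVertex i) : P.IsGatherable 2 := by
  by_contra hnot
  have hbad : ∀ a : ℤ, ∃ v w : ℤ, a < v ∧ v < w ∧ w < a + n ∧ P.IsStable (P.vtx a) v ∧
      P.IsStable (P.vtx a) w ∧ dotAt (P.vtx a) (P.vtx v) (P.vtx w) < 0 := by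
    intro a
    by_contra! hgood
    refine hnot (hP.isGatherable_two a fun v w hav hvw hwa hv hw =>
      ⟨hgood v w hav hvw hwa hv hw, Or.inl ?_⟩)
    by_contra! hv
    exact h _ (isAcuteVertex_intCast_iff.2 hv)
  obtain ⟨v, w, hv, hvw, hw, hs, -⟩ := hbad 0
  exact hP.not_isStable_of_forall_obtuse hbad 0 v hv (by omega) (Or.inl hs)

end IsConvexCCW

end Polygon

theorem theorem2 (n : ℕ) (P : Polygon (EuclideanSpace ℝ (Fin 2)) n) (hP : P.IsConvexCCW)
    (hacute : {i : Fin n | P.IsAcuteVertex i}.ncard ≤ 2) : P.IsGatherable 2 := by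
  have : NeZero n := ⟨by linarith [hP.three_le]⟩
  by_cases h : ∃ i, P.IsAcuteVertex i
  · obtain ⟨i, hi⟩ := h
    exact hP.isGatherable_two_of_isAcuteVertex hacute hi
  · exact hP.isGatherable_two_of_forall_not_isAcuteVertex (not_exists.1 h)
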